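/- Let $k\in\mathbb{N}$ and $g\in\mathbb{R}$. There are constants $c,C>0$, depending only on $k$ and $g$, such that the following holds. Consider $N$ spins, each with Hilbert space $\mathbb{C}^d$ ($N$ and $d$ arbitrary), and a Hermitian operator $H=\sum_{|X|\le k}h_X$ on $(\mathbb{C}^d)^{\otimes N}$, where the sum runs over the sets $X$ of at most $k$ spins, each $h_X$ is supported on $X$, and $\sum_{|X|\le k,\,X\ni i}\|h_X\|\le g$ for every spin $i$. Assume that the lowest eigenvalue $E_0$ of $H$ is non-degenerate, let $\Omega$ be the corresponding normalized eigenvector, let $E_1>E_0$ be the second lowest eigenvalue, and $\delta E=E_1-E_0$. Let $L$ be a non-empty set of spins and $A_L=\sum_{i\in L}a_i$ an additive operator on $L$: each $a_i$ is Hermitian, acts only on the spin $i$, and has $\|a_i\|\le 1$. Write $\langle A_L\rangle=\langle\Omega|A_L|\Omega\rangle$, $(\Delta A_L)^2=\langle\Omega|A_L^2|\Omega\rangle-\langle A_L\rangle^2$, and let $\Pi^{A}_{\ge x}$ be the orthogonal projector onto the span of the eigenvectors of $A_L$ with eigenvalues $\ge x$. Then for every $h>0$ $$\bigl\|\Pi^{A}_{\ge\langle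 A_L\rangle+h}\,\Omega\bigr\|\le e^{-c\,h\sqrt{\delta E/|L|}},$$ and $$\delta E\cdot(\Delta A_L)^2\le C\,|L|.$$ In particular, if $L$ is the whole system and $A=A_L$, then $(\Delta A)^2\le C\,N/\delta E$, and the Fisher information $\mathcal{F}(\Omega,A)=4(\Delta A)^2$ is at most $4C\,N/\delta E$. -/

import Mathlib

namespace SpinSystem

/-- The Hilbert space `(ℂ^d)^{⊗ N}` of `N` spins of local dimension `d`, in the product basis
labelled by the configurations `σ : Fin N → Fin d`. -/
abbrev Space (N d : ℕ) : Type := EuclideanSpace ℂ (Fin N → Fin d)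

/-- Operators on the `N`-spin Hilbert space, with the operator norm. -/
abbrev Op (N d : ℕ) : Type := Space N d →L[ℂ] Space N d

/-- `O` is supported on the set `X` of spins: `O = M ⊗ 𝟙` with `M` acting on the spins in `X`
and the identity on all the other spins, written out in matrix elements `⟨σ|O|τ⟩`. -/
def IsSupportedOn {N d : ℕ} (O : Op N d) (X : Finset (Fin N)) : Prop :=
  ∃ M : Matrix (X → Fin d) (X → Fin d) ℂ, ∀ σ τ : Fin N → Fin d,
    O (EuclideanSpace.single τ 1) σ =
      if ∀ i, i ∉ X → σ i = τ i then M (fun i => σ i) (fun i => τ i) else 0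

/-- `H` is a `k`-local Hamiltonian of interaction strength at most `g`:
a self-adjoint `H = ∑_{|X| ≤ k} h_X` with `h_X` supported on `X` and
`∑_{X ∋ i} ‖h_X‖ ≤ g` for every spin `i`. -/
def IsLocalHamiltonian {N d : ℕ} (k : ℕ) (g : ℝ) (H : Op N d) : Prop :=
  IsSelfAdjoint H ∧
  ∃ h : Finset (Fin N) → Op N d,
    (∀ X, X.card ≤ k → IsSupportedOn (h X) X) ∧
    H = ∑ X : Finset (Fin N) with X.card ≤ k, h X ∧
    ∀ i : Fin N, ∑ X : Finset (Fin N) with X.card ≤ k ∧ i ∈ X, ‖h X‖ ≤ g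

/-- The real number `E` is an eigenvalue of `H`. -/
def IsEnergy {N d : ℕ} (H : Op N d) (E : ℝ) : Prop :=
  Module.End.HasEigenvalue (H : Space N d →ₗ[ℂ] Space N d) (E : ℂ)

/-- `Ω` is a normalized vector spanning the eigenspace of the lowest energy `E₀` of `H`,
i.e. `H` has a unique ground state, `Ω`, of energy `E₀`. -/
structure IsUniqueGroundState {N d : ℕ} (H : Op N d) (E₀ : ℝ) (Ω : Space N d) : Prop where
  norm_eq_one : ‖Ω‖ = 1
  isLeast : IsLeast {E : ℝ | IsEnergy H E} E₀
  eigenspace_eq :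
    Module.End.eigenspace (H : Space N d →ₗ[ℂ] Space N d) (E₀ : ℂ) = Submodule.span ℂ {Ω}

/-- `δE = E₁ - E₀`, where `E₁` is the smallest energy of `H` above `E₀`. -/
def IsSpectralGap {N d : ℕ} (H : Op N d) (E₀ δE : ℝ) : Prop :=
  IsLeast {E : ℝ | IsEnergy H E ∧ E₀ < E} (E₀ + δE)

/-- `A` is an additive operator on `L`: `A = ∑_{i ∈ L} a_i` with `a_i` Hermitian, of norm at
most `1`, and acting on the spin `i` only. -/
def IsAdditiveOn {N d : ℕ} (L : Finset (Fin N)) (A : Op N d) : Prop :=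
  ∃ a : Fin N → Op N d,
    (∀ i ∈ L, IsSelfAdjoint (a i) ∧ ‖a i‖ ≤ 1 ∧ IsSupportedOn (a i) {i}) ∧
    A = ∑ i ∈ L, a i

/-- The sum of the eigenspaces of `A` for the eigenvalues `≥ x`. -/
def spectralSubspaceGE {N d : ℕ} (A : Op N d) (x : ℝ) : Submodule ℂ (Space N d) :=
  ⨆ μ : {μ : ℝ // x ≤ μ},
    Module.End.eigenspace (A : Space N d →ₗ[ℂ] Space N d) ((μ : ℝ) : ℂ)

/-- The orthogonal projector `Π^A_{≥ x}` onto the eigenspaces of `A` with eigenvalues `≥ x`. -/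
noncomputable def spectralProjGE {N d : ℕ} (A : Op N d) (x : ℝ) : Op N d :=
  (spectralSubspaceGE A x).starProjection

/-- The expectation `⟨ψ|A|ψ⟩` (which is real for Hermitian `A`). -/
noncomputable def expectation {N d : ℕ} (A : Op N d) (ψ : Space N d) : ℝ :=
  (inner ℂ ψ (A ψ)).re

/-- The squared fluctuation `(ΔA)² = ⟨ψ|A²|ψ⟩ - ⟨ψ|A|ψ⟩²`. -/
noncomputable def variance {N d : ℕ} (A : Op N d) (ψ : Space N d) : ℝ :=
  expectation (A ^ 2) ψ - expectation A ψ ^ 2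

/-- The quantum Fisher information `4 (ΔA)²` of the pure state `ψ` with respect to `A`. -/
noncomputable def fisherInformation {N d : ℕ} (A : Op N d) (ψ : Space N d) : ℝ :=
  4 * variance A ψ

end SpinSystem

/-!
Measuring an additive operator `A = ∑ a_i` in the ground state `Ω` gives a probability distribution
on the spectrum of `A`. The gap turns into a Poincaré inequality for this distribution, and
everything else is a statement about real random variables.

*Poincaré inequality.* For a real function `f`, the variational principle bounds `δE` times the
variance of `f(A)` by `⟨Ω|[f(A), [H, f(A)]]|Ω⟩ / 2` (`gap_mul_le_re_inner_doubleCommutator`), which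
is a sum over the interactions `h_X`. The part `B` of `A` outside of `X` commutes with `h_X`, so in
the `X`-term `f(A)` may be replaced by `f(A) - f(B)`. If `f` is `1`-Lipschitz, the norm of this
difference is at most the number of spins in `X ∩ L`, because all the `a_i` are diagonal in a common
eigenbasis. If moreover `f` is locally constant outside of `S`, the difference is localized on the
event `A ∈ S` (`re_inner_doubleCommutator_le`). Summing over `X` gives
`δE * Var f(A) ≤ 2 * k * g * |L| * P(A ∈ S)` (`IsAdditiveOn.exists_localPoincare`), and `f = id` is
the bound on the variance.

*Concentration.* For a ramp function `f` the inequality says that the tail of the distribution drops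
by a constant factor over a distance of order `√(|L| / δE)`, which gives exponential decay
(`LocalPoincare.tail_le_exp_neg_nat`). The absence of a prefactor needs an argument for small `h`:
for `f(x) = max (t - x) 0`, the inequality bounds the mean of the part of `A` below `⟨A⟩ + h` by the
probability of that part, so that this probability is at least proportional to `h * √(δE / |L|)`
(`LocalPoincare.le_mass_Iio`). Both arguments treat the jump length `2 * k` as a distance of order
`√(|L| / δE)`. This is legitimate because `δE ≤ 4 * g` (`gap_le`): the matrix units of a single spin
provide excitations of energy of order `g`.
-/

namespace SpinSystem

/-! ### Operators diagonal in an orthonormal basis -/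

section Diagonal

open Module End

variable {E ι : Type*} [NormedAddCommGroup E] [InnerProductSpace ℂ E] [Fintype ι]

/-- Finitely many commuting self-adjoint operators have a common orthonormal eigenbasis. -/
theorem exists_orthonormalBasis_of_commute [FiniteDimensional ℂ E] {κ : Type*} [Finite κ]
    (T : κ → E →L[ℂ] E)
    (hT : ∀ i, IsSelfAdjoint (T i)) (hC : ∀ i j, Commute (T i) (T j)) :
    ∃ (n : ℕ) (b : OrthonormalBasis (Fin n) ℂ E) (α : κ → Fin n → ℝ),
      ∀ i j, T i (b j) = ((α i j : ℝ) : ℂ) • b j := by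
  classical
  let T' : κ → E →ₗ[ℂ] E := fun i => (T i : E →ₗ[ℂ] E)
  have hsym : ∀ i, (T' i).IsSymmetric := fun i => (hT i).isSymmetric
  have hcomm : Pairwise (Function.onFun Commute T') := by
    intro i j _
    have := hC i j
    ext v
    exact congrArg (fun S : E →L[ℂ] E => S v) this.eq
  let V : (κ → ℂ) → Submodule ℂ E := fun χ => ⨅ i, eigenspace (T' i) (χ i)
  have hint : DirectSum.IsInternal V :=
    LinearMap.IsSymmetric.directSum_isInternal_of_pairwise_commute hsym hcomm
  have hort : OrthogonalFamily ℂ (fun χ => V χ) fun χ => (V χ).subtypeₗᵢ :=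
    LinearMap.IsSymmetric.orthogonalFamily_iInf_eigenspaces hsym
  have hint' := (DirectSum.isInternal_ne_bot_iff (A := V)).mpr hint
  have hort' : OrthogonalFamily ℂ (fun χ : {χ // V χ ≠ ⊥} => V χ)
      fun χ => (V χ).subtypeₗᵢ := hort.comp Subtype.val_injective
  let _ : Fintype {χ // V χ ≠ ⊥} :=
    iSupIndep.fintypeNeBotOfFiniteDimensional hint.submodule_iSupIndep
  let b := hint'.subordinateOrthonormalBasis rfl hort'
  have hb : ∀ i j, ∃ r : ℝ, T i (b j) = (r : ℂ) • b j := by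
    intro i j
    have h1 := hint'.subordinateOrthonormalBasis_subordinate rfl j hort'
    have h2 := (Submodule.mem_iInf _).mp h1 i
    rw [mem_eigenspace_iff] at h2
    set μ := (hint'.subordinateOrthonormalBasisIndex rfl j hort').1 i
    have hne : b j ≠ 0 := b.orthonormal.ne_zero j
    have hev : HasEigenvalue (T' i) μ :=
      hasEigenvalue_of_hasEigenvector ⟨mem_eigenspace_iff.mpr h2, hne⟩
    have hre : (starRingEnd ℂ) μ = μ := (hsym i).conj_eigenvalue_eq_self hev
    refine ⟨μ.re, ?_⟩
    rw [Complex.conj_eq_iff_re.mp hre]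
    exact h2
  choose α hα using hb
  exact ⟨_, b, α, hα⟩

/-- The operator with eigenvalues `w j` on the vectors `b j` of an orthonormal basis. -/
noncomputable def diagOp (b : OrthonormalBasis ι ℂ E) (w : ι → ℝ) : E →L[ℂ] E :=
  ∑ j, (w j : ℂ) • (innerSL ℂ (b j)).smulRight (b j)

variable (b : OrthonormalBasis ι ℂ E)

theorem repr_diagOp (w : ι → ℝ) (v : E) (j : ι) :
    b.repr (diagOp b w v) j = w j * b.repr v j := by
  classical
  simp [diagOp, b.repr_apply_apply, Pi.single_apply, -Complex.coe_smul]

theorem ext_repr {v w : E} (h : ∀ j, b.repr v j = b.repr w j) : v = w :=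
  b.repr.injective (by ext j; exact h j)

theorem diagOp_apply_self (w : ι → ℝ) (i : ι) : diagOp b w (b i) = (w i : ℂ) • b i := by
  classical
  refine ext_repr b fun j => ?_
  rw [repr_diagOp]
  by_cases hij : j = i
  · subst hij; simp [-Complex.coe_smul]
  · simp [hij, -Complex.coe_smul]

theorem eq_diagOp {T : E →L[ℂ] E} {w : ι → ℝ} (h : ∀ j, T (b j) = (w j : ℂ) • b j) :
    T = diagOp b w := by
  classical
  have : (T : E →ₗ[ℂ] E) = (diagOp b w : E →ₗ[ℂ] E) := by
    refine b.toBasis.ext fun i => ?_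
    simp only [OrthonormalBasis.coe_toBasis, ContinuousLinearMap.coe_coe, h, diagOp_apply_self]
  exact ContinuousLinearMap.coe_injective this

theorem diagOp_mul (w z : ι → ℝ) : diagOp b w * diagOp b z = diagOp b (fun j => w j * z j) := by
  ext v
  refine ext_repr b fun j => ?_
  simp [repr_diagOp, mul_assoc]

theorem diagOp_sub (w z : ι → ℝ) : diagOp b w - diagOp b z = diagOp b (fun j => w j - z j) := by
  ext v
  refine ext_repr b fun j => ?_
  simp [repr_diagOp, sub_mul]

theorem diagOp_commute (w z : ι → ℝ) : Commute (diagOp b w) (diagOp b z) := by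
  unfold Commute SemiconjBy
  simp only [diagOp_mul, mul_comm]

theorem inner_eq_sum_repr (v w : E) :
    inner ℂ v w = ∑ j, (starRingEnd ℂ) (b.repr v j) * b.repr w j := by
  rw [← b.repr.inner_map_map, PiLp.inner_apply]
  simp [mul_comm]

theorem norm_sq_eq_sum_repr (v : E) : ‖v‖ ^ 2 = ∑ j, ‖b.repr v j‖ ^ 2 := by
  rw [← b.repr.norm_map, EuclideanSpace.norm_sq_eq]

theorem isSelfAdjoint_diagOp [CompleteSpace E] (w : ι → ℝ) : IsSelfAdjoint (diagOp b w) := by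
  rw [ContinuousLinearMap.isSelfAdjoint_iff_isSymmetric]
  intro x y
  simp only [ContinuousLinearMap.coe_coe]
  rw [inner_eq_sum_repr b, inner_eq_sum_repr b]
  refine Finset.sum_congr rfl fun j _ => ?_
  rw [repr_diagOp, repr_diagOp, map_mul, Complex.conj_ofReal]
  ring

theorem inner_diagOp (w : ι → ℝ) (v : E) :
    inner ℂ v (diagOp b w v) = ((∑ j, w j * ‖b.repr v j‖ ^ 2 : ℝ) : ℂ) := by
  rw [inner_eq_sum_repr b]
  push_cast
  refine Finset.sum_congr rfl fun j _ => ?_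
  rw [repr_diagOp, ← Complex.conj_mul']
  ring

theorem norm_sq_diagOp_apply (w : ι → ℝ) (v : E) :
    ‖diagOp b w v‖ ^ 2 = ∑ j, w j ^ 2 * ‖b.repr v j‖ ^ 2 := by
  rw [norm_sq_eq_sum_repr b]
  refine Finset.sum_congr rfl fun j _ => ?_
  rw [repr_diagOp, norm_mul, mul_pow, Complex.norm_real, Real.norm_eq_abs, sq_abs]

theorem norm_diagOp_le {w : ι → ℝ} {C : ℝ} (hC : 0 ≤ C) (h : ∀ j, |w j| ≤ C) :
    ‖diagOp b w‖ ≤ C := by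
  refine ContinuousLinearMap.opNorm_le_bound _ hC fun v => ?_
  refine abs_le_of_sq_le_sq' ?_ (by positivity) |>.2
  rw [norm_sq_diagOp_apply, mul_pow, norm_sq_eq_sum_repr b, Finset.mul_sum]
  refine Finset.sum_le_sum fun j _ => ?_
  gcongr ?_ * _
  exact sq_le_sq' (neg_le_of_abs_le (h j)) (le_of_abs_le (h j))

/-- An operator commuting with a diagonal operator commutes with every function of it. -/
theorem commute_diagOp_comp {T : E →L[ℂ] E} {β : ι → ℝ} (h : Commute T (diagOp b β))
    (φ : ℝ → ℝ) : Commute T (diagOp b (fun j => φ (β j))) := by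
  classical
  -- `T` has no matrix elements between eigenvectors of different eigenvalues
  have key : ∀ i j, (φ (β j) : ℂ) * b.repr (T (b i)) j = φ (β i) * b.repr (T (b i)) j := by
    intro i j
    by_cases hij : β j = β i
    · rw [hij]
    · have h1 : T (diagOp b β (b i)) = diagOp b β (T (b i)) :=
        congrArg (fun S : E →L[ℂ] E => S (b i)) h.eq
      have h3 := congrArg (fun v => b.repr v j) h1
      simp only [diagOp_apply_self, map_smul, repr_diagOp] at h3
      have h4 : ((β i : ℂ) - β j) * b.repr (T (b i)) j = 0 := by
        rw [sub_mul, sub_eq_zero]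
        simpa [-Complex.coe_smul] using h3
      have h5 : ((β i : ℂ) - β j) ≠ 0 := by
        rw [sub_ne_zero]
        exact fun h => hij (by exact_mod_cast h.symm)
      rw [(mul_eq_zero.mp h4).resolve_left h5]
      simp
  have : ((T * diagOp b (fun j => φ (β j)) : E →L[ℂ] E) : E →ₗ[ℂ] E) =
      (diagOp b (fun j => φ (β j)) * T : E →L[ℂ] E) := by
    refine b.toBasis.ext fun i => ?_
    simp only [OrthonormalBasis.coe_toBasis, ContinuousLinearMap.coe_coe,
      mul_apply_eq_comp]
    refine ext_repr b fun j => ?_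
    rw [diagOp_apply_self, map_smul, repr_diagOp, key i j]
    simp [-Complex.coe_smul]
  exact ContinuousLinearMap.coe_injective this

end Diagonal

end SpinSystem

namespace SpinSystem

/-! ### Concentration of a discrete distribution with a local Poincaré inequality -/

section Concentration

variable {ι : Type*} [Fintype ι]

/-- The probability of the event `a ∈ S` under the weights `p`. -/
noncomputable def mass (p a : ι → ℝ) (S : Set ℝ) : ℝ :=
  ∑ j, S.indicator 1 (a j) * p j

/-- The weights `p` on the points `a` satisfy a Poincaré inequality at inverse length scale `s`,
with jumps of length up to `κ`: the variance of a `1`-Lipschitz function is controlled by the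
probability of any set outside of which the function does not change under jumps. -/
def LocalPoincare (p a : ι → ℝ) (κ K s : ℝ) : Prop :=
  ∀ (f : ℝ → ℝ) (S : Set ℝ), LipschitzWith 1 f →
    (∀ x ∉ S, ∀ y, |y - x| ≤ κ → f y = f x) →
    s ^ 2 * (∑ j, p j * f (a j) ^ 2 - (∑ j, p j * f (a j)) ^ 2) ≤ K * mass p a S

variable {p a : ι → ℝ}

theorem mass_nonneg (hp : ∀ j, 0 ≤ p j) (S : Set ℝ) : 0 ≤ mass p a S :=
  Finset.sum_nonneg fun j _ =>
    mul_nonneg (Set.indicator_nonneg (fun _ _ => zero_le_one) _) (hp j)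

theorem mass_mono (hp : ∀ j, 0 ≤ p j) {S T : Set ℝ} (h : S ⊆ T) : mass p a S ≤ mass p a T :=
  Finset.sum_le_sum fun j _ => mul_le_mul_of_nonneg_right
    (Set.indicator_le_indicator_of_subset h (fun _ => zero_le_one) _) (hp j)

theorem mass_univ (h1 : ∑ j, p j = 1) : mass p a Set.univ = 1 := by
  simp [mass, h1]

theorem mass_compl (h1 : ∑ j, p j = 1) (S : Set ℝ) : mass p a Sᶜ = 1 - mass p a S := by
  rw [← h1, mass, mass, ← Finset.sum_sub_distrib]
  refine Finset.sum_congr rfl fun j _ => ?_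
  by_cases h : a j ∈ S <;> simp [h]

/-- If `F` vanishes off `S`, then Cauchy–Schwarz bounds its mean by its second moment on `S`. -/
theorem sq_sum_le_mass_mul (hp : ∀ j, 0 ≤ p j) {F : ℝ → ℝ} {S : Set ℝ} (hF : ∀ x ∉ S, F x = 0) :
    (∑ j, p j * F (a j)) ^ 2 ≤ mass p a S * ∑ j, p j * F (a j) ^ 2 := by
  refine Finset.sum_sq_le_sum_mul_sum_of_sq_le_mul _ (fun j _ =>
    mul_nonneg (Set.indicator_nonneg (fun _ _ => zero_le_one) _) (hp j))
    (fun j _ => mul_nonneg (hp j) (sq_nonneg _)) fun j _ => ?_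
  by_cases h : a j ∈ S
  · simp only [Set.indicator_of_mem h, Pi.one_apply]; exact le_of_eq (by ring)
  · simp [hF _ h]

/-- If `F` vanishes off an event of probability at most `1/2`, then its second moment is at most
twice its variance, to which the Poincaré inequality applies. -/
theorem LocalPoincare.second_moment_le {κ K s : ℝ} (hP : LocalPoincare p a κ K s)
    (hp : ∀ j, 0 ≤ p j) {F : ℝ → ℝ} {S T : Set ℝ} (hL : LipschitzWith 1 F)
    (hS : ∀ x ∉ S, ∀ y, |y - x| ≤ κ → F y = F x) (hT : ∀ x ∉ T, F x = 0)
    (hT2 : mass p a T ≤ 1 / 2) :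
    s ^ 2 * ∑ j, p j * F (a j) ^ 2 ≤ 2 * K * mass p a S := by
  have h1 := hP F S hL hS
  have h2 := sq_sum_le_mass_mul (a := a) hp hT
  have h3 : 0 ≤ ∑ j, p j * F (a j) ^ 2 :=
    Finset.sum_nonneg fun j _ => mul_nonneg (hp j) (sq_nonneg _)
  have h4 : (∑ j, p j * F (a j)) ^ 2 ≤ (∑ j, p j * F (a j) ^ 2) / 2 := by nlinarith
  nlinarith [sq_nonneg s]

/-- Chebyshev's inequality. -/
theorem LocalPoincare.chebyshev {κ K s : ℝ} (hP : LocalPoincare p a κ K s)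
    (hp : ∀ j, 0 ≤ p j) (h1 : ∑ j, p j = 1) {h : ℝ} (hh : 0 < h) :
    (s * h) ^ 2 * mass p a (Set.Ici (∑ j, p j * a j + h)) ≤ K := by
  have hv := hP id Set.univ LipschitzWith.id (by simp)
  rw [mass_univ h1] at hv
  set m := ∑ j, p j * a j with hm
  have hvar : ∑ j, p j * (a j - m) ^ 2 = ∑ j, p j * a j ^ 2 - m ^ 2 := by
    have : ∀ j, p j * (a j - m) ^ 2 = p j * a j ^ 2 - 2 * m * (p j * a j) + m ^ 2 * p j := by
      intro j; ring
    simp only [this, Finset.sum_add_distrib, Finset.sum_sub_distrib, ← Finset.mul_sum, h1, ← hm]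
    ring
  have h2 : h ^ 2 * mass p a (Set.Ici (m + h)) ≤ ∑ j, p j * (a j - m) ^ 2 := by
    rw [mass, Finset.mul_sum]
    refine Finset.sum_le_sum fun j _ => ?_
    by_cases hj : m + h ≤ a j
    · rw [Set.indicator_of_mem (Set.mem_Ici.mpr hj), Pi.one_apply, one_mul, mul_comm]
      exact mul_le_mul_of_nonneg_left (pow_le_pow_left₀ hh.le (by linarith) 2) (hp j)
    · rw [Set.indicator_of_notMem (by simpa using hj)]
      have := mul_nonneg (hp j) (sq_nonneg (a j - m))
      simpa using this
  rw [hvar] at h2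
  simp only [id] at hv
  calc (s * h) ^ 2 * mass p a (Set.Ici (m + h))
      = s ^ 2 * (h ^ 2 * mass p a (Set.Ici (m + h))) := by ring
    _ ≤ s ^ 2 * (∑ j, p j * a j ^ 2 - m ^ 2) := mul_le_mul_of_nonneg_left h2 (sq_nonneg s)
    _ ≤ K := by linarith

/-- The ramp function, of slope `1` on `[t + κ, t + κ + w]` and constant elsewhere, turns the
Poincaré inequality into a comparison of the tail at `t + κ + w` with the tail at `t`. -/
theorem LocalPoincare.tail_step {κ K s : ℝ} (hP : LocalPoincare p a κ K s)
    (hp : ∀ j, 0 ≤ p j) (hκ : 0 ≤ κ) {t w : ℝ} (hw : 0 ≤ w)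
    (ht : mass p a (Set.Ici (t + κ)) ≤ 1 / 2) :
    (s * w) ^ 2 * mass p a (Set.Ici (t + κ + w)) ≤ 2 * K * mass p a (Set.Ici t) := by
  let F : ℝ → ℝ := fun x => min (max (x - (t + κ)) 0) w
  have hL : LipschitzWith 1 F := by
    have : LipschitzWith 1 (fun x : ℝ => x - (t + κ)) :=
      LipschitzWith.of_dist_le_mul fun x y => by simp
    exact (this.max_const 0).min_const w
  have h1 := hP.second_moment_le hp (F := F) (S := Set.Ici t) (T := Set.Ici (t + κ)) hL
    (by
      intro x hx y hy
      have hx' : x < t := by simpa using hx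
      have hy' := (abs_le.mp hy).2
      simp only [F]
      rw [max_eq_right (by linarith), max_eq_right (by linarith)])
    (by
      intro x hx
      have hx' : x < t + κ := by simpa using hx
      simp only [F]
      rw [max_eq_right (by linarith), min_eq_left hw]) ht
  have h2 : w ^ 2 * mass p a (Set.Ici (t + κ + w)) ≤ ∑ j, p j * F (a j) ^ 2 := by
    rw [mass, Finset.mul_sum]
    refine Finset.sum_le_sum fun j _ => ?_
    by_cases hj : t + κ + w ≤ a j
    · rw [Set.indicator_of_mem (Set.mem_Ici.mpr hj), Pi.one_apply, one_mul, mul_comm]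
      have : F (a j) = w := by
        simp only [F]
        rw [max_eq_left (by linarith), min_eq_right (by linarith)]
      rw [this]
    · rw [Set.indicator_of_notMem (by simpa using hj)]
      have := mul_nonneg (hp j) (sq_nonneg (F (a j)))
      simpa using this
  calc (s * w) ^ 2 * mass p a (Set.Ici (t + κ + w))
      = s ^ 2 * (w ^ 2 * mass p a (Set.Ici (t + κ + w))) := by ring
    _ ≤ s ^ 2 * ∑ j, p j * F (a j) ^ 2 := mul_le_mul_of_nonneg_left h2 (sq_nonneg s)
    _ ≤ _ := h1

/-- Iterating `LocalPoincare.tail_step` with steps of length `M + √(8K)` in units of `1 / s`, each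
of which reduces the tail by a factor `4 ≥ e`. -/
theorem LocalPoincare.tail_le_exp_neg_nat {κ K s M : ℝ} (hP : LocalPoincare p a κ K s)
    (hp : ∀ j, 0 ≤ p j) (h1 : ∑ j, p j = 1) (hκ : 0 ≤ κ) (hK : 0 < K) (hs : 0 < s)
    (hM : s * κ ≤ M) (n : ℕ) {h : ℝ} (hh : √(8 * K) + n * (M + √(8 * K)) ≤ h * s) :
    mass p a (Set.Ici (∑ j, p j * a j + h)) ≤ Real.exp (-n) / 2 := by
  set l := √(8 * K) with hl
  have hl2 : l ^ 2 = 8 * K := Real.sq_sqrt (by positivity)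
  have hl0 : 0 < l := Real.sqrt_pos.mpr (by positivity)
  have hM0 : 0 ≤ M := (mul_nonneg hs.le hκ).trans hM
  induction n generalizing h with
  | zero =>
    simp only [Nat.cast_zero, zero_mul, add_zero] at hh
    have hh0 : 0 < h := pos_of_mul_pos_left (hl0.trans_le hh) hs.le
    have h2 := hP.chebyshev hp h1 hh0
    have h3 : 8 * K ≤ (s * h) ^ 2 := by
      rw [← hl2, mul_comm]; exact pow_le_pow_left₀ hl0.le hh 2
    have h4 := mass_nonneg (a := a) hp (Set.Ici (∑ j, p j * a j + h))
    have h5 : 8 * K * mass p a (Set.Ici (∑ j, p j * a j + h)) ≤ K * 1 := by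
      rw [mul_one]
      exact (mul_le_mul_of_nonneg_right h3 h4).trans h2
    have h6 : 8 * mass p a (Set.Ici (∑ j, p j * a j + h)) ≤ 1 :=
      le_of_mul_le_mul_left (by linarith) hK
    simp only [Nat.cast_zero, neg_zero, Real.exp_zero]
    linarith
  | succ n ih =>
    push_cast at hh
    have ih1 := ih (h := h - κ - l / s) (by
      have : (h - κ - l / s) * s = h * s - s * κ - l := by field_simp
      rw [this]
      linarith)
    set m := ∑ j, p j * a j
    have hhalf : mass p a (Set.Ici (m + (h - κ - l / s) + κ)) ≤ 1 / 2 := by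
      refine (mass_mono hp (Set.Ici_subset_Ici.mpr (by linarith))).trans (ih1.trans ?_)
      have : Real.exp (-(n : ℝ)) ≤ 1 := Real.exp_le_one_iff.mpr (by simp)
      linarith
    have h2 := hP.tail_step hp hκ (w := l / s) (by positivity) hhalf
    have e1 : m + (h - κ - l / s) + κ + l / s = m + h := by ring
    have e2 : s * (l / s) = l := by field_simp
    rw [e1, e2, hl2] at h2
    have h3 : 4 * mass p a (Set.Ici (m + h)) ≤ mass p a (Set.Ici (m + (h - κ - l / s))) :=
      le_of_mul_le_mul_left (by linarith) (by linarith : (0 : ℝ) < 2 * K)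
    have h4 : Real.exp (-(n : ℝ)) ≤ 4 * Real.exp (-((n + 1 : ℕ) : ℝ)) := by
      have : Real.exp (-(n : ℝ)) = Real.exp 1 * Real.exp (-((n + 1 : ℕ) : ℝ)) := by
        rw [← Real.exp_add]; push_cast; congr 1; ring
      rw [this]
      exact mul_le_mul_of_nonneg_right (by linarith [Real.exp_one_lt_three]) (Real.exp_pos _).le
    linarith

/-- The event of lying below `mean + h` cannot be too unlikely: its probability `ε` is at least
proportional to `h * s`. This gives the tail bound without a prefactor. -/
theorem LocalPoincare.le_mass_Iio {κ K s M : ℝ} (hP : LocalPoincare p a κ K s)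
    (hp : ∀ j, 0 ≤ p j) (h1 : ∑ j, p j = 1) (hκ : 0 ≤ κ) (hK : 0 < K) (hs : 0 < s)
    (hM : s * κ ≤ M) {h : ℝ}
    (hhalf : mass p a (Set.Iio (∑ j, p j * a j + h)) ≤ 1 / 2) :
    h * s ≤ (M + √(8 * K)) * mass p a (Set.Iio (∑ j, p j * a j + h)) := by
  set m := ∑ j, p j * a j with hm
  set ε := mass p a (Set.Iio (m + h)) with hε
  have hε0 : 0 ≤ ε := mass_nonneg hp _
  -- the cut-off lies one jump below `m + h`, so that only points below `m + h` contribute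
  let F : ℝ → ℝ := fun x => max (m + h - κ - x) 0
  have hL : LipschitzWith 1 F := by
    have : LipschitzWith 1 (fun x : ℝ => m + h - κ - x) := by
      refine LipschitzWith.of_dist_le_mul fun x y => ?_
      rw [NNReal.coe_one, one_mul, dist_sub_left]
    exact this.max_const 0
  have h0 : ∀ x ∉ Set.Iio (m + h), F x = 0 := by
    intro x hx
    have hx' : m + h ≤ x := by simpa using hx
    exact max_eq_right (by linarith)
  have h2 := hP.second_moment_le hp (F := F) (S := Set.Iio (m + h)) (T := Set.Iio (m + h)) hL
    (by
      intro x hx y hy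
      have hx' : m + h ≤ x := by simpa using hx
      have hy' := (abs_le.mp hy).1
      rw [h0 x hx]
      exact max_eq_right (by linarith)) h0 hhalf
  have h3 := sq_sum_le_mass_mul (a := a) hp h0
  have h4 : (s * ∑ j, p j * F (a j)) ^ 2 ≤ (√(8 * K) * ε) ^ 2 := by
    rw [mul_pow, mul_pow, Real.sq_sqrt (by positivity)]
    calc s ^ 2 * (∑ j, p j * F (a j)) ^ 2 ≤ s ^ 2 * (ε * ∑ j, p j * F (a j) ^ 2) :=
          mul_le_mul_of_nonneg_left h3 (sq_nonneg s)
      _ = ε * (s ^ 2 * ∑ j, p j * F (a j) ^ 2) := by ring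
      _ ≤ ε * (2 * K * ε) := mul_le_mul_of_nonneg_left h2 hε0
      _ ≤ 8 * K * ε ^ 2 := by nlinarith [mul_nonneg hK.le (sq_nonneg ε)]
  have h5 : s * ∑ j, p j * F (a j) ≤ √(8 * K) * ε :=
    (abs_le_of_sq_le_sq' h4 (by positivity)).2
  have h6 : h ≤ κ * ε + ∑ j, p j * F (a j) := by
    have : h = ∑ j, p j * (m + h - a j) := by
      simp only [mul_sub, Finset.sum_sub_distrib, ← Finset.sum_mul, h1, ← hm]
      ring
    rw [this, hε, mass, Finset.mul_sum, ← Finset.sum_add_distrib]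
    refine Finset.sum_le_sum fun j _ => ?_
    by_cases hj : a j < m + h
    · rw [Set.indicator_of_mem (Set.mem_Iio.mpr hj), Pi.one_apply]
      have : m + h - κ - a j ≤ F (a j) := le_max_left _ _
      nlinarith [hp j]
    · rw [Set.indicator_of_notMem (by simpa using hj), h0 _ (by simpa using hj)]
      have := mul_nonneg (hp j) (sub_nonneg.mpr (not_lt.mp hj))
      linarith
  calc h * s ≤ (κ * ε + ∑ j, p j * F (a j)) * s := mul_le_mul_of_nonneg_right h6 hs.le
    _ = s * κ * ε + s * ∑ j, p j * F (a j) := by ring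
    _ ≤ M * ε + √(8 * K) * ε := add_le_add (mul_le_mul_of_nonneg_right hM hε0) h5
    _ = _ := by ring

/-- A local Poincaré inequality implies exponential concentration, with prefactor `1`. -/
theorem LocalPoincare.sqrt_tail_le {κ K s M : ℝ} (hP : LocalPoincare p a κ K s)
    (hp : ∀ j, 0 ≤ p j) (h1 : ∑ j, p j = 1) (hκ : 0 ≤ κ) (hK : 0 < K) (hs : 0 < s)
    (hM : s * κ ≤ M) {h : ℝ} (hh : 0 < h) :
    √(mass p a (Set.Ici (∑ j, p j * a j + h))) ≤
      Real.exp (-(1 / (16 * (M + √(8 * K))) * h * s)) := by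
  set m := ∑ j, p j * a j with hm
  set l := √(8 * K) with hl
  have hl0 : 0 < l := Real.sqrt_pos.mpr (by positivity)
  have hM0 : 0 ≤ M := (mul_nonneg hs.le hκ).trans hM
  set Λ := M + l with hΛ
  have hΛ0 : 0 < Λ := by positivity
  have hu0 : 0 < h * s := mul_pos hh hs
  -- `v` is the deviation in units of `Λ / s`
  obtain ⟨v, hv⟩ : ∃ v, v = h * s / Λ := ⟨_, rfl⟩
  have hvu : h * s = v * Λ := by rw [hv]; field_simp
  have hv0 : 0 < v := by rw [hv]; positivity
  suffices H : mass p a (Set.Ici (m + h)) ≤ Real.exp (-(v / 8)) by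
    have e : -(1 / (16 * Λ) * h * s) = -(v / 8) / 2 := by
      rw [hv]; field_simp; ring
    rw [e, Real.exp_half]
    exact Real.sqrt_le_sqrt H
  -- the exponential decay has a constant prefactor, which is harmless for `4 ≤ v`
  by_cases hv4 : 4 ≤ v
  · have hfl : v - 2 ≤ (⌊v - 1⌋₊ : ℝ) := by linarith [Nat.lt_floor_add_one (v - 1)]
    have hfu : (⌊v - 1⌋₊ : ℝ) ≤ v - 1 := Nat.floor_le (by linarith)
    have h2 := hP.tail_le_exp_neg_nat hp h1 hκ hK hs hM ⌊v - 1⌋₊ (h := h) (by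
      rw [← hl, ← hΛ, hvu]
      nlinarith)
    refine h2.trans ?_
    have h3 : Real.exp (-(⌊v - 1⌋₊ : ℝ)) ≤ Real.exp (-(v / 8)) :=
      Real.exp_le_exp.mpr (by linarith)
    linarith [Real.exp_pos (-(⌊v - 1⌋₊ : ℝ))]
  · have hc := mass_compl (a := a) h1 (Set.Iio (m + h))
    rw [Set.compl_Iio] at hc
    have h3 : v / 8 ≤ mass p a (Set.Iio (m + h)) := by
      by_cases hhalf : mass p a (Set.Iio (m + h)) ≤ 1 / 2
      · have h2 := hP.le_mass_Iio hp h1 hκ hK hs hM hhalf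
        rw [← hl, ← hΛ, ← hm, hvu, mul_comm] at h2
        have := le_of_mul_le_mul_left h2 hΛ0
        linarith
      · linarith
    linarith [Real.add_one_le_exp (-(v / 8))]

end Concentration

end SpinSystem

namespace SpinSystem

/-! ### Operators with disjoint supports -/

section Support

variable {N d : ℕ}

theorem op_apply_eq_sum (O : Op N d) (v : Space N d) (σ : Fin N → Fin d) :
    O v σ = ∑ τ, v τ * O (EuclideanSpace.single τ 1) σ := by
  classical
  have h : v = ∑ τ, v τ • EuclideanSpace.single τ (1 : ℂ) := by
    ext ρ
    simp [Finset.sum_apply, Pi.single_apply]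
  conv_lhs => rw [h]
  simp [Finset.sum_apply]

theorem op_ext {O O' : Op N d} (h : ∀ σ τ, O (EuclideanSpace.single τ 1) σ =
    O' (EuclideanSpace.single τ 1) σ) : O = O' := by
  ext v σ
  rw [op_apply_eq_sum, op_apply_eq_sum O']
  simp only [h]

/-- The matrix elements of a product of two operators with disjoint supports: only one
intermediate configuration contributes. -/
theorem apply_apply_single {O O' : Op N d} {X Y : Finset (Fin N)} (hXY : Disjoint X Y)
    {M : Matrix (X → Fin d) (X → Fin d) ℂ} {M' : Matrix (Y → Fin d) (Y → Fin d) ℂ}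
    (hM : ∀ σ τ : Fin N → Fin d, O (EuclideanSpace.single τ 1) σ =
      if ∀ i, i ∉ X → σ i = τ i then M (fun i => σ i) (fun i => τ i) else 0)
    (hM' : ∀ σ τ : Fin N → Fin d, O' (EuclideanSpace.single τ 1) σ =
      if ∀ i, i ∉ Y → σ i = τ i then M' (fun i => σ i) (fun i => τ i) else 0)
    (σ τ : Fin N → Fin d) :
    O (O' (EuclideanSpace.single τ 1)) σ =
      if ∀ i, i ∉ X → i ∉ Y → σ i = τ i then
        M (fun i => σ i) (fun i => τ i) * M' (fun i => σ i) (fun i => τ i) else 0 := by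
  classical
  rw [op_apply_eq_sum O]
  let ρ₀ : Fin N → Fin d := fun i => if i ∈ X then τ i else σ i
  rw [Finset.sum_eq_single ρ₀]
  · rw [hM σ ρ₀, if_pos (by intro i hi; simp [ρ₀, hi]), hM']
    have e1 : (fun i : X => ρ₀ i) = fun i : X => τ i := by
      funext i; simp [ρ₀]
    have e2 : (fun i : Y => ρ₀ i) = fun i : Y => σ i := by
      funext i
      have : (i : Fin N) ∉ X := fun h => Finset.disjoint_left.mp hXY h i.2
      simp [ρ₀, this]
    rw [e1, e2]
    have e3 : (∀ i, i ∉ Y → ρ₀ i = τ i) ↔ (∀ i, i ∉ X → i ∉ Y → σ i = τ i) := by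
      refine ⟨fun h i hX hY => ?_, fun h i hY => ?_⟩
      · simpa [ρ₀, hX] using h i hY
      · by_cases hX : i ∈ X
        · simp [ρ₀, hX]
        · simpa [ρ₀, hX] using h i hX hY
    simp only [e3]
    split_ifs <;> ring
  · intro ρ _ hne
    rw [hM, hM']
    by_cases h1 : ∀ i, i ∉ X → σ i = ρ i
    · by_cases h2 : ∀ i, i ∉ Y → ρ i = τ i
      · refine absurd (funext fun i => ?_) hne
        by_cases hX : i ∈ X
        · simp [ρ₀, hX, h2 i (Finset.disjoint_left.mp hXY hX)]
        · simp [ρ₀, hX, h1 i hX]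
      · rw [if_neg h2, zero_mul]
    · rw [if_neg h1, mul_zero]
  · simp

theorem IsSupportedOn.commute {O O' : Op N d} {X Y : Finset (Fin N)} (hO : IsSupportedOn O X)
    (hO' : IsSupportedOn O' Y) (hXY : Disjoint X Y) : Commute O O' := by
  obtain ⟨M, hM⟩ := hO
  obtain ⟨M', hM'⟩ := hO'
  refine op_ext fun σ τ => ?_
  rw [mul_apply_eq_comp, mul_apply_eq_comp, apply_apply_single hXY hM hM',
    apply_apply_single hXY.symm hM' hM]
  refine if_congr ?_ (mul_comm _ _) rfl
  exact forall_congr' fun i => ⟨fun h a b => h b a, fun h a b => h b a⟩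

end Support

/-! ### The variational principle for the spectral gap -/

section Gap

variable {N d : ℕ} {H : Op N d} {E₀ δE : ℝ} {Ω : Space N d}

theorem IsUniqueGroundState.apply_eq (hg : IsUniqueGroundState H E₀ Ω) : H Ω = (E₀ : ℂ) • Ω := by
  have : Ω ∈ Module.End.eigenspace (H : Space N d →ₗ[ℂ] Space N d) (E₀ : ℂ) := by
    rw [hg.eigenspace_eq]; exact Submodule.mem_span_singleton_self Ω
  exact Module.End.mem_eigenspace_iff.mp this

theorem IsSpectralGap.pos (hgap : IsSpectralGap H E₀ δE) : 0 < δE := by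
  have := hgap.1.2
  linarith

theorem gap_mul_norm_sq_le_of_inner_eq_zero (hH : IsSelfAdjoint H)
    (hg : IsUniqueGroundState H E₀ Ω) (hgap : IsSpectralGap H E₀ δE) {ψ : Space N d}
    (hψ : inner ℂ ψ Ω = 0) :
    δE * ‖ψ‖ ^ 2 ≤ (inner ℂ ψ (H ψ)).re - E₀ * ‖ψ‖ ^ 2 := by
  have hs : (H : Space N d →ₗ[ℂ] Space N d).IsSymmetric := hH.isSymmetric
  let u := hs.eigenvectorBasis rfl
  let l := hs.eigenvalues rfl
  have hHu : H = diagOp u l := eq_diagOp u fun j => hs.apply_eigenvectorBasis rfl j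
  have hi : (inner ℂ ψ (H ψ)).re = ∑ j, l j * ‖u.repr ψ j‖ ^ 2 := by
    conv_lhs => rw [hHu]
    rw [inner_diagOp, Complex.ofReal_re]
  rw [hi, norm_sq_eq_sum_repr u, Finset.mul_sum, Finset.mul_sum, ← Finset.sum_sub_distrib]
  refine Finset.sum_le_sum fun j _ => ?_
  have hev : IsEnergy H (l j) := hs.hasEigenvalue_eigenvalues rfl j
  have hle : E₀ ≤ l j := hg.isLeast.2 hev
  rcases hle.eq_or_lt with heq | hlt
  · have hmem : u j ∈ Module.End.eigenspace (H : Space N d →ₗ[ℂ] Space N d) (E₀ : ℂ) := by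
      rw [heq, Module.End.mem_eigenspace_iff]
      exact hs.apply_eigenvectorBasis rfl j
    rw [hg.eigenspace_eq, Submodule.mem_span_singleton] at hmem
    obtain ⟨z, hz⟩ := hmem
    have h0 : u.repr ψ j = 0 := by
      rw [u.repr_apply_apply, ← hz, inner_smul_left, ← inner_conj_symm, hψ]
      simp
    simp [h0]
  · have := hgap.2 ⟨hev, hlt⟩
    have h0 := sq_nonneg ‖u.repr ψ j‖
    nlinarith

/-- The energy of `φ` above the ground state is at least the gap times the weight of `φ` outside
the ground state. -/
theorem gap_mul_le (hH : IsSelfAdjoint H) (hg : IsUniqueGroundState H E₀ Ω)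
    (hgap : IsSpectralGap H E₀ δE) (φ : Space N d) :
    δE * (‖φ‖ ^ 2 - ‖inner ℂ Ω φ‖ ^ 2) ≤ (inner ℂ φ (H φ)).re - E₀ * ‖φ‖ ^ 2 := by
  obtain ⟨c, hc⟩ : ∃ c, c = inner ℂ Ω φ := ⟨_, rfl⟩
  obtain ⟨ψ, hψ⟩ : ∃ ψ, ψ = φ - c • Ω := ⟨_, rfl⟩
  have hφ : φ = ψ + c • Ω := by rw [hψ]; abel
  have hΩΩ : inner ℂ Ω Ω = (1 : ℂ) := by
    rw [inner_self_eq_norm_sq_to_K, hg.norm_eq_one]; simp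
  have hort' : inner ℂ Ω ψ = 0 := by
    rw [hψ, inner_sub_right, inner_smul_right, hΩΩ, ← hc]; simp
  have hort : inner ℂ ψ Ω = 0 := by
    rw [← inner_conj_symm, hort', map_zero]
  have hHΩ := hg.apply_eq
  have hcross : inner ℂ Ω (H ψ) = 0 := by
    have := hH.isSymmetric Ω ψ
    simp only [ContinuousLinearMap.coe_coe] at this
    rw [← this, hHΩ, inner_smul_left, hort', mul_zero]
  have hnorm : ‖φ‖ ^ 2 = ‖ψ‖ ^ 2 + ‖c‖ ^ 2 := by
    have h := norm_add_sq_eq_norm_sq_add_norm_sq_of_inner_eq_zero (𝕜 := ℂ) ψ (c • Ω)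
      (by rw [inner_smul_right, hort, mul_zero])
    rw [← hφ, norm_smul, hg.norm_eq_one, mul_one] at h
    nlinarith
  have hen : (inner ℂ φ (H φ)).re = (inner ℂ ψ (H ψ)).re + E₀ * ‖c‖ ^ 2 := by
    have : inner ℂ φ (H φ) = inner ℂ ψ (H ψ) + ((E₀ * ‖c‖ ^ 2 : ℝ) : ℂ) := by
      rw [hφ, map_add, map_smul, hHΩ]
      simp only [inner_add_left, inner_add_right, inner_smul_left, inner_smul_right, hort, hcross,
        hΩΩ]
      push_cast
      rw [← Complex.conj_mul']
      ring
    rw [this, Complex.add_re, Complex.ofReal_re]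
  have h1 := gap_mul_norm_sq_le_of_inner_eq_zero hH hg hgap hort
  rw [hen, ← hc, hnorm]
  linarith

/-- The excitation energy of `a Ω` is the expectation of a commutator. -/
theorem gap_mul_le_re_inner_commutator (hH : IsSelfAdjoint H) (hg : IsUniqueGroundState H E₀ Ω)
    (hgap : IsSpectralGap H E₀ δE) (a : Op N d) :
    δE * (‖a Ω‖ ^ 2 - ‖inner ℂ Ω (a Ω)‖ ^ 2) ≤ (inner ℂ (a Ω) ((H * a - a * H) Ω)).re := by
  refine (gap_mul_le hH hg hgap (a Ω)).trans (le_of_eq ?_)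
  rw [sub_apply, mul_apply_eq_comp, mul_apply_eq_comp, hg.apply_eq, map_smul,
    inner_sub_right, inner_smul_right, inner_self_eq_norm_sq_to_K, Complex.sub_re]
  congr 1
  rw [Complex.re_ofReal_mul]
  norm_cast

/-- A system with two different energies has spins with at least two states. -/
theorem two_le_of_gap (hH : IsSelfAdjoint H) (hg : IsUniqueGroundState H E₀ Ω)
    (hgap : IsSpectralGap H E₀ δE) : 2 ≤ d := by
  by_contra hd
  have hsub : Subsingleton (Fin d) := Fin.subsingleton_iff_le_one.mpr (by omega)
  obtain ⟨v, hv, hv0⟩ := hgap.1.1.exists_hasEigenvector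
  rw [Module.End.mem_eigenspace_iff] at hv
  -- two eigenvectors of different energies are orthogonal, but there is only one configuration
  have hort : inner ℂ Ω v = 0 := by
    have h1 := hH.isSymmetric Ω v
    rw [hv] at h1
    simp only [ContinuousLinearMap.coe_coe] at h1
    rw [hg.apply_eq, inner_smul_left, inner_smul_right, Complex.conj_ofReal] at h1
    have h2 : ((δE : ℝ) : ℂ) * inner ℂ Ω v = 0 := by
      push_cast at h1
      linear_combination -h1
    exact (mul_eq_zero.mp h2).resolve_left (by exact_mod_cast hgap.pos.ne')
  have hΩ0 : Ω ≠ 0 := by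
    intro h
    have := hg.norm_eq_one
    simp [h] at this
  obtain ⟨σ, hσ⟩ : ∃ σ, Ω σ ≠ 0 := by
    by_contra! h
    exact hΩ0 (by ext σ; simpa using h σ)
  obtain ⟨τ, hτ⟩ : ∃ σ, v σ ≠ 0 := by
    by_contra! h
    exact hv0 (by ext σ; simpa using h σ)
  have hτσ : τ = σ := Subsingleton.elim _ _
  subst hτσ
  rw [PiLp.inner_apply, Fintype.sum_subsingleton _ τ] at hort
  simp [hσ, hτ] at hort

end Gap

/-! ### The gap is at most of the order of the interaction strength -/

section MatrixUnits

variable {N d : ℕ}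

/-- The matrix unit `|j⟩⟨l|` acting on the spin `i`. -/
noncomputable def siteUnit (i : Fin N) (j l : Fin d) : Op N d :=
  LinearMap.toContinuousLinearMap
    { toFun := fun ψ => WithLp.toLp 2 fun σ => if σ i = j then ψ (Function.update σ i l) else 0
      map_add' := fun ψ φ => by
        ext σ
        by_cases h : σ i = j <;> simp [h]
      map_smul' := fun c ψ => by
        ext σ
        by_cases h : σ i = j <;> simp [h] }

theorem siteUnit_apply (i : Fin N) (j l : Fin d) (ψ : Space N d) (σ : Fin N → Fin d) :
    siteUnit i j l ψ σ = if σ i = j then ψ (Function.update σ i l) else 0 := rfl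

theorem isSupportedOn_siteUnit (i : Fin N) (j l : Fin d) :
    IsSupportedOn (siteUnit i j l) {i} := by
  refine ⟨fun x y => if x ⟨i, by simp⟩ = j ∧ y ⟨i, by simp⟩ = l then 1 else 0, fun σ τ => ?_⟩
  rw [siteUnit_apply, PiLp.single_apply]
  have : (Function.update σ i l = τ) ↔ (∀ m, m ∉ ({i} : Finset (Fin N)) → σ m = τ m) ∧ τ i = l := by
    rw [Function.update_eq_iff]
    simp only [Finset.mem_singleton]
    tauto
  simp only [this]
  split_ifs <;> tauto

theorem siteUnit_siteUnit (i : Fin N) (j l m : Fin d) (ψ : Space N d) :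
    siteUnit i j l (siteUnit i l m ψ) = siteUnit i j m ψ := by
  ext σ
  simp [siteUnit_apply]

theorem sum_siteUnit (i : Fin N) (ψ : Space N d) : ∑ l, siteUnit i l l ψ = ψ := by
  ext σ
  simp [siteUnit_apply, Finset.sum_apply]

theorem inner_siteUnit_right (i : Fin N) (j l : Fin d) (φ ψ : Space N d) :
    inner ℂ φ (siteUnit i j l ψ) = inner ℂ (siteUnit i l j φ) ψ := by
  rw [PiLp.inner_apply, PiLp.inner_apply]
  simp only [siteUnit_apply, RCLike.inner_apply, ite_mul, zero_mul, apply_ite (starRingEnd ℂ),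
    mul_ite, map_zero, mul_zero]
  rw [← Finset.sum_filter, ← Finset.sum_filter]
  refine Finset.sum_bij' (fun σ _ => Function.update σ i l) (fun σ _ => Function.update σ i j)
    ?_ ?_ ?_ ?_ ?_
  · simp
  · simp
  · intro σ hσ
    have : σ i = j := by simpa using hσ
    simp [← this]
  · intro σ hσ
    have : σ i = l := by simpa using hσ
    simp [← this]
  · intro σ hσ
    have : σ i = j := by simpa using hσ
    simp [← this]

theorem inner_siteUnit_siteUnit (i : Fin N) (j l : Fin d) (φ ψ : Space N d) :
    inner ℂ (siteUnit i j l φ) (siteUnit i j l ψ) = inner ℂ φ (siteUnit i l l ψ) := by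
  rw [← inner_siteUnit_right, siteUnit_siteUnit]

theorem sum_inner_siteUnit (i : Fin N) (φ ψ : Space N d) :
    ∑ j, ∑ l, inner ℂ (siteUnit i j l φ) (siteUnit i j l ψ) = d * inner ℂ φ ψ := by
  simp only [inner_siteUnit_siteUnit, ← inner_sum, sum_siteUnit]
  rw [Finset.sum_const, Finset.card_univ, Fintype.card_fin, ← Nat.cast_smul_eq_nsmul ℂ,
    inner_smul_right]

theorem norm_sq_siteUnit (i : Fin N) (j l : Fin d) (ψ : Space N d) :
    ‖siteUnit i j l ψ‖ ^ 2 = ‖siteUnit i l l ψ‖ ^ 2 := by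
  have h1 := inner_siteUnit_siteUnit i j l ψ ψ
  rw [← inner_siteUnit_siteUnit i l l ψ ψ, inner_self_eq_norm_sq_to_K,
    inner_self_eq_norm_sq_to_K] at h1
  exact_mod_cast h1

theorem sum_norm_sq_siteUnit (i : Fin N) (ψ : Space N d) :
    ∑ l, ‖siteUnit i l l ψ‖ ^ 2 = ‖ψ‖ ^ 2 := by
  have h : ((∑ l, ‖siteUnit i l l ψ‖ ^ 2 : ℝ) : ℂ) = ((‖ψ‖ ^ 2 : ℝ) : ℂ) := by
    push_cast
    have e : ∀ v : Space N d, ((‖v‖ : ℂ)) ^ 2 = inner ℂ v v := fun v =>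
      (inner_self_eq_norm_sq_to_K v).symm
    simp only [e, inner_siteUnit_siteUnit, ← inner_sum, sum_siteUnit]
  exact_mod_cast h

/-- The squared Hilbert–Schmidt norm of a reduced density matrix is at most the squared trace. -/
theorem sum_norm_sq_inner_siteUnit_le (i : Fin N) (ψ : Space N d) :
    ∑ j, ∑ l, ‖inner ℂ ψ (siteUnit i j l ψ)‖ ^ 2 ≤ (‖ψ‖ ^ 2) ^ 2 := by
  rw [← sum_norm_sq_siteUnit i ψ, sq (∑ l, ‖siteUnit i l l ψ‖ ^ 2), Finset.sum_mul_sum]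
  refine Finset.sum_le_sum fun j _ => Finset.sum_le_sum fun l _ => ?_
  rw [← siteUnit_siteUnit i j j l ψ, inner_siteUnit_right, ← norm_sq_siteUnit i j l, ← mul_pow]
  exact pow_le_pow_left₀ (norm_nonneg _) (norm_inner_le_norm _ _) 2

/-- The gap is bounded by the strength `g` of the interactions of a single spin: the excitations
`|j⟩⟨l| Ω` of the spin `i` have squared norms adding up to `d`, of which at least `d - 1` lies
outside the ground state, while their energies above the ground state add up to at most
`2 * d * g`. -/
theorem gap_le {k : ℕ} {g : ℝ} {H : Op N d} {E₀ δE : ℝ} {Ω : Space N d}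
    (hH : IsLocalHamiltonian k g H) (hg : IsUniqueGroundState H E₀ Ω)
    (hgap : IsSpectralGap H E₀ δE) (i : Fin N) : δE ≤ 4 * g := by
  obtain ⟨hsa, h, hsupp, hsum, hle⟩ := hH
  have hd : (2 : ℝ) ≤ d := by exact_mod_cast two_le_of_gap hsa hg hgap
  have hΩ := hg.norm_eq_one
  have hnorm : ∑ j, ∑ l, ‖siteUnit i j l Ω‖ ^ 2 = (d : ℝ) := by
    have : ∀ j : Fin d, ∑ l, ‖siteUnit i j l Ω‖ ^ 2 = 1 := fun j => by
      rw [Finset.sum_congr rfl fun l _ => norm_sq_siteUnit i j l Ω, sum_norm_sq_siteUnit, hΩ,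
        one_pow]
    simp [this]
  have hlow : δE * (d - 1) ≤
      ∑ j, ∑ l, (inner ℂ (siteUnit i j l Ω) ((H * siteUnit i j l - siteUnit i j l * H) Ω)).re := by
    have h1 := sum_norm_sq_inner_siteUnit_le i Ω
    rw [hΩ] at h1
    have h2 : δE * (d - 1) ≤ ∑ j, ∑ l, δE * (‖siteUnit i j l Ω‖ ^ 2 -
        ‖inner ℂ Ω (siteUnit i j l Ω)‖ ^ 2) := by
      simp only [← Finset.mul_sum, Finset.sum_sub_distrib, hnorm]
      exact mul_le_mul_of_nonneg_left (by linarith) hgap.pos.le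
    exact h2.trans (Finset.sum_le_sum fun j _ => Finset.sum_le_sum fun l _ =>
      gap_mul_le_re_inner_commutator hsa hg hgap _)
  have hterm : ∀ X : Finset (Fin N), ∑ j, ∑ l,
      (inner ℂ (siteUnit i j l Ω) ((h X * siteUnit i j l - siteUnit i j l * h X) Ω)).re ≤
        2 * d * ‖h X‖ := by
    intro X
    have e : ∑ j, ∑ l,
        (inner ℂ (siteUnit i j l Ω) ((h X * siteUnit i j l - siteUnit i j l * h X) Ω)).re =
        ∑ j, ∑ l, (inner ℂ (siteUnit i j l Ω) (h X (siteUnit i j l Ω))).re -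
          (∑ j, ∑ l, inner ℂ (siteUnit i j l Ω) (siteUnit i j l (h X Ω))).re := by
      simp only [Complex.re_sum, ← Finset.sum_sub_distrib, sub_apply,
        mul_apply_eq_comp, inner_sub_right, Complex.sub_re]
    rw [e, sum_inner_siteUnit]
    have h1 : ∑ j, ∑ l, (inner ℂ (siteUnit i j l Ω) (h X (siteUnit i j l Ω))).re ≤ d * ‖h X‖ := by
      rw [← hnorm, Finset.sum_mul]
      refine Finset.sum_le_sum fun j _ => ?_
      rw [Finset.sum_mul]
      refine Finset.sum_le_sum fun l _ => ?_
      have := (h X).le_opNorm (siteUnit i j l Ω)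
      calc _ ≤ ‖siteUnit i j l Ω‖ * ‖h X (siteUnit i j l Ω)‖ := re_inner_le_norm (𝕜 := ℂ) _ _
        _ ≤ ‖siteUnit i j l Ω‖ * (‖h X‖ * ‖siteUnit i j l Ω‖) := by gcongr
        _ = _ := by ring
    have h2 : -((d : ℂ) * inner ℂ Ω (h X Ω)).re ≤ d * ‖h X‖ := by
      refine (neg_le_abs _).trans ((Complex.abs_re_le_norm _).trans ?_)
      rw [norm_mul, Complex.norm_natCast]
      gcongr
      refine (norm_inner_le_norm _ _).trans ?_
      have := (h X).le_opNorm Ω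
      rw [hΩ] at this ⊢
      linarith
    linarith
  have hzero : ∀ X : Finset (Fin N), X.card ≤ k → i ∉ X → ∀ j l,
      h X * siteUnit i j l - siteUnit i j l * h X = 0 := by
    intro X hX hiX j l
    exact sub_eq_zero.mpr ((hsupp X hX).commute (isSupportedOn_siteUnit i j l)
      (Finset.disjoint_singleton_right.mpr hiX))
  have hup : ∑ j, ∑ l, (inner ℂ (siteUnit i j l Ω)
      ((H * siteUnit i j l - siteUnit i j l * H) Ω)).re ≤ 2 * d * g := by
    have e : ∀ j l : Fin d, H * siteUnit i j l - siteUnit i j l * H =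
        ∑ X : Finset (Fin N) with X.card ≤ k ∧ i ∈ X,
          (h X * siteUnit i j l - siteUnit i j l * h X) := by
      intro j l
      rw [← Finset.filter_filter, Finset.sum_filter_of_ne, hsum, Finset.sum_mul, Finset.mul_sum,
        Finset.sum_sub_distrib]
      intro X hX hne
      by_contra hiX
      exact hne (hzero X (by simpa using hX) hiX j l)
    have e2 : ∑ j, ∑ l, (inner ℂ (siteUnit i j l Ω)
        ((H * siteUnit i j l - siteUnit i j l * H) Ω)).re =
        ∑ X : Finset (Fin N) with X.card ≤ k ∧ i ∈ X, ∑ j, ∑ l,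
          (inner ℂ (siteUnit i j l Ω) ((h X * siteUnit i j l - siteUnit i j l * h X) Ω)).re := by
      simp only [e, sum_apply, inner_sum, Complex.re_sum]
      exact (Finset.sum_congr rfl fun j _ => Finset.sum_comm).trans Finset.sum_comm
    rw [e2]
    refine (Finset.sum_le_sum fun X _ => hterm X).trans ?_
    rw [← Finset.mul_sum]
    exact mul_le_mul_of_nonneg_left (hle i) (by positivity)
  have hδ := hgap.pos
  have h3 : δE * (d / 2) ≤ δE * (d - 1) := mul_le_mul_of_nonneg_left (by linarith) hδ.le
  have h4 : δE * d ≤ 4 * g * d := by linarith [hlow.trans hup]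
  exact le_of_mul_le_mul_right h4 (by linarith)

end MatrixUnits

end SpinSystem

namespace SpinSystem

/-! ### The Poincaré inequality of the ground state for functions of an additive operator -/

section DoubleCommutator

variable {E ι : Type*} [NormedAddCommGroup E] [InnerProductSpace ℂ E] [Fintype ι]

/-- The double commutator `[F, [h, F]]`. -/
def doubleCommutator (F h : E →L[ℂ] E) : E →L[ℂ] E :=
  F * (h * F - F * h) - (h * F - F * h) * F

theorem doubleCommutator_sum {κ : Type*} (s : Finset κ) (F : E →L[ℂ] E) (h : κ → E →L[ℂ] E) :
    doubleCommutator F (∑ X ∈ s, h X) = ∑ X ∈ s, doubleCommutator F (h X) := by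
  simp only [doubleCommutator, Finset.sum_mul, Finset.mul_sum, Finset.sum_sub_distrib, mul_sub,
    sub_mul]

/-- Adding to `F` an operator that commutes with `F` and `h` does not change `[F, [h, F]]`. -/
theorem doubleCommutator_add {D G h : E →L[ℂ] E} (hD : Commute G D) (hh : Commute G h) :
    doubleCommutator (D + G) h = doubleCommutator D h := by
  have e : h * (D + G) - (D + G) * h = h * D - D * h := by
    rw [mul_add, add_mul, hh.eq]; abel
  have hc : Commute G (h * D - D * h) := (hh.mul_right hD).sub_right (hD.mul_right hh)
  rw [doubleCommutator, e, add_mul, mul_add, hc.eq, doubleCommutator]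
  abel

/-- Localization of the double commutator by an operator `R` that commutes with `h` and is the
identity where `D` does not vanish. -/
theorem doubleCommutator_eq_conj {D R h : E →L[ℂ] E} (h1 : D * R = D) (h2 : R * D = D)
    (hR : Commute R h) : doubleCommutator D h = R * doubleCommutator D h * R := by
  have hc : Commute R (h * D - D * h) := by
    have hD : Commute R D := h2.trans h1.symm
    exact (hR.mul_right hD).sub_right (hD.mul_right hR)
  have e1 : R * (D * (h * D - D * h)) * R = D * (h * D - D * h) := by
    rw [← mul_assoc, h2, mul_assoc, ← hc.eq, ← mul_assoc, h1]
  have e2 : R * ((h * D - D * h) * D) * R = (h * D - D * h) * D := by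
    rw [mul_assoc, mul_assoc, h1, ← mul_assoc, hc.eq, mul_assoc, h2]
  conv_rhs => rw [doubleCommutator, mul_sub R (D * (h * D - D * h)), sub_mul _ _ R, e1, e2]
  rfl

theorem norm_doubleCommutator_le {D h : E →L[ℂ] E} {m : ℝ} (hm : ‖D‖ ≤ m) :
    ‖doubleCommutator D h‖ ≤ 4 * m ^ 2 * ‖h‖ := by
  have hm0 : 0 ≤ m := (norm_nonneg _).trans hm
  have h1 : ‖h * D‖ ≤ m * ‖h‖ := by
    rw [mul_comm m]
    exact (norm_mul_le _ _).trans (mul_le_mul_of_nonneg_left hm (norm_nonneg _))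
  have h2 : ‖D * h‖ ≤ m * ‖h‖ :=
    (norm_mul_le _ _).trans (mul_le_mul_of_nonneg_right hm (norm_nonneg _))
  have hc : ‖h * D - D * h‖ ≤ 2 * m * ‖h‖ := by
    refine (norm_sub_le _ _).trans ?_
    linarith
  have h3 : ‖D * (h * D - D * h)‖ ≤ m * (2 * m * ‖h‖) :=
    (norm_mul_le _ _).trans (mul_le_mul hm hc (norm_nonneg _) hm0)
  have h4 : ‖(h * D - D * h) * D‖ ≤ 2 * m * ‖h‖ * m :=
    (norm_mul_le _ _).trans (mul_le_mul hc hm (norm_nonneg _) (by positivity))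
  refine (norm_sub_le _ _).trans ?_
  linarith

/-- Let `x` and `β` be the joint spectra of an operator `A = B + Z`, where `B` commutes with `h`
and `‖Z‖ ≤ m`. In `[f(A), [h, f(A)]]` the function `f(A)` may be replaced by `f(A) - f(B)`, which
is of norm at most `m`, and which vanishes where `A ∉ S`, by the choice of `S`. -/
theorem re_inner_doubleCommutator_le [CompleteSpace E] (b : OrthonormalBasis ι ℂ E) {x β : ι → ℝ}
    {h : E →L[ℂ] E} (hβ : Commute h (diagOp b β)) {m κ : ℝ} (hm : ∀ j, |x j - β j| ≤ m)
    (hκ : 2 * m ≤ κ) {f : ℝ → ℝ} (hf : LipschitzWith 1 f) {S : Set ℝ}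
    (hS : ∀ y ∉ S, ∀ z, |z - y| ≤ κ → f z = f y) (v : E) :
    (inner ℂ v (doubleCommutator (diagOp b fun j => f (x j)) h v)).re ≤
      4 * m ^ 2 * ‖h‖ * mass (fun j => ‖b.repr v j‖ ^ 2) x S := by
  classical
  rcases isEmpty_or_nonempty ι with hι | ⟨⟨j₀⟩⟩
  · have hv : v = 0 := ext_repr b fun j => isEmptyElim j
    simp [hv, mass]
  have hm0 : 0 ≤ m := (abs_nonneg _).trans (hm j₀)
  let F := diagOp b fun j => f (x j)
  let G := diagOp b fun j => f (β j)
  let D := diagOp b fun j => f (x j) - f (β j)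
  -- the indicator of the values of `B` that are compatible with `f(A) ≠ f(B)`
  let φ : ℝ → ℝ := fun y => if ∃ l, β l = y ∧ f (x l) ≠ f y then 1 else 0
  let R := diagOp b fun j => φ (β j)
  have hF : F = D + G := by
    have : D = F - G := (diagOp_sub b _ _).symm
    rw [this, sub_add_cancel]
  have hmul : ∀ j, (f (x j) - f (β j)) * φ (β j) = f (x j) - f (β j) := by
    intro j
    by_cases hj : f (x j) = f (β j)
    · rw [hj, sub_self, zero_mul]
    · have : φ (β j) = 1 := if_pos ⟨j, rfl, hj⟩
      rw [this, mul_one]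
  have hDR : D * R = D := by
    simp only [D, R, diagOp_mul, hmul]
  have hRD : R * D = D := by rw [(diagOp_commute b _ _).eq]; exact hDR
  have hRh : Commute R h := (commute_diagOp_comp b hβ φ).symm
  have hGh : Commute G h := (commute_diagOp_comp b hβ f).symm
  have hDn : ‖D‖ ≤ m := norm_diagOp_le b hm0 fun j => by
    have := hf.dist_le_mul (x j) (β j)
    rw [NNReal.coe_one, one_mul, Real.dist_eq, Real.dist_eq] at this
    exact this.trans (hm j)
  have hRv : ‖R v‖ ^ 2 ≤ mass (fun j => ‖b.repr v j‖ ^ 2) x S := by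
    rw [norm_sq_diagOp_apply]
    refine Finset.sum_le_sum fun j _ => mul_le_mul_of_nonneg_right ?_ (sq_nonneg _)
    by_cases hj : ∃ l, β l = β j ∧ f (x l) ≠ f (β j)
    · have h1 : φ (β j) = 1 := if_pos hj
      obtain ⟨l, hl, hne⟩ := hj
      have hmem : x j ∈ S := by
        by_contra hx
        have h3 := abs_le.mp (hm l)
        have h4 := abs_le.mp (hm j)
        rw [hl] at h3
        refine hne ((hS _ hx _ ?_).trans (hS _ hx _ ?_).symm) <;> rw [abs_le] <;>
          constructor <;> linarith
      rw [h1, Set.indicator_of_mem hmem]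
      simp
    · have h1 : φ (β j) = 0 := if_neg hj
      have h2 : 0 ≤ S.indicator (1 : ℝ → ℝ) (x j) :=
        Set.indicator_nonneg (fun _ _ => zero_le_one) _
      rw [h1]
      simpa using h2
  have hkey : doubleCommutator F h = R * doubleCommutator D h * R := by
    rw [hF, doubleCommutator_add (diagOp_commute b _ _) hGh]
    exact doubleCommutator_eq_conj hDR hRD hRh
  change (inner ℂ v (doubleCommutator F h v)).re ≤ _
  have hRs : inner ℂ v (R (doubleCommutator D h (R v))) =
      inner ℂ (R v) (doubleCommutator D h (R v)) :=
    ((isSelfAdjoint_diagOp b _).isSymmetric v _).symm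
  rw [hkey, mul_apply_eq_comp, mul_apply_eq_comp, hRs]
  calc _ ≤ ‖R v‖ * ‖doubleCommutator D h (R v)‖ := re_inner_le_norm (𝕜 := ℂ) _ _
    _ ≤ ‖R v‖ * (4 * m ^ 2 * ‖h‖ * ‖R v‖) := by
        gcongr
        exact (ContinuousLinearMap.le_opNorm _ _).trans
          (mul_le_mul_of_nonneg_right (norm_doubleCommutator_le hDn) (norm_nonneg _))
    _ = 4 * m ^ 2 * ‖h‖ * ‖R v‖ ^ 2 := by ring
    _ ≤ _ := by gcongr

end DoubleCommutator

section Poincare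

variable {N d : ℕ}

/-- For a Hermitian `a`, the excitation energy of `a Ω` is half the expectation of the double
commutator of `a` with `H`. -/
theorem gap_mul_le_re_inner_doubleCommutator {H : Op N d} {E₀ δE : ℝ} {Ω : Space N d}
    (hH : IsSelfAdjoint H) (hg : IsUniqueGroundState H E₀ Ω) (hgap : IsSpectralGap H E₀ δE)
    {a : Op N d} (ha : IsSelfAdjoint a) :
    δE * (‖a Ω‖ ^ 2 - ‖inner ℂ Ω (a Ω)‖ ^ 2) ≤
      (inner ℂ Ω (doubleCommutator a H Ω)).re / 2 := by
  refine (gap_mul_le_re_inner_commutator hH hg hgap a).trans (le_of_eq ?_)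
  have sa : ∀ u v, inner ℂ u (a v) = inner ℂ (a u) v := fun u v => (ha.isSymmetric u v).symm
  have sH : ∀ u v, inner ℂ u (H v) = inner ℂ (H u) v := fun u v => (hH.isSymmetric u v).symm
  have e1 : inner ℂ Ω (a ((H * a - a * H) Ω)) = inner ℂ (a Ω) ((H * a - a * H) Ω) := sa _ _
  have e2 : (inner ℂ Ω ((H * a - a * H) (a Ω))).re =
      -(inner ℂ (a Ω) ((H * a - a * H) Ω)).re := by
    have : inner ℂ Ω ((H * a - a * H) (a Ω)) = -inner ℂ ((H * a - a * H) Ω) (a Ω) := by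
      simp only [sub_apply, mul_apply_eq_comp, inner_sub_right, inner_sub_left, map_sub, sa, sH]
      ring
    rw [this, Complex.neg_re, ← inner_conj_symm, Complex.conj_re]
  have e3 : inner ℂ Ω (doubleCommutator a H Ω) =
      inner ℂ Ω (a ((H * a - a * H) Ω)) - inner ℂ Ω ((H * a - a * H) (a Ω)) := by
    rw [← inner_sub_right]; rfl
  rw [e3, Complex.sub_re, e1, e2]
  ring

/-- Each interaction is counted once for each spin of `L` on which it acts. -/
theorem sum_card_mul_norm_le {k : ℕ} {g : ℝ} {h : Finset (Fin N) → Op N d}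
    (hle : ∀ i : Fin N, ∑ X : Finset (Fin N) with X.card ≤ k ∧ i ∈ X, ‖h X‖ ≤ g)
    (L : Finset (Fin N)) :
    ∑ X : Finset (Fin N) with X.card ≤ k, ((L.filter (· ∈ X)).card : ℝ) * ‖h X‖ ≤ g * L.card := by
  calc _ = ∑ X : Finset (Fin N) with X.card ≤ k, ∑ i ∈ L, if i ∈ X then ‖h X‖ else 0 := by
        refine Finset.sum_congr rfl fun X _ => ?_
        rw [← Finset.sum_filter, Finset.sum_const, nsmul_eq_mul]
    _ = ∑ i ∈ L, ∑ X : Finset (Fin N) with X.card ≤ k ∧ i ∈ X, ‖h X‖ := by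
        rw [Finset.sum_comm]
        refine Finset.sum_congr rfl fun i _ => ?_
        rw [← Finset.sum_filter, Finset.filter_filter]
    _ ≤ ∑ i ∈ L, g := Finset.sum_le_sum fun i _ => hle i
    _ = g * L.card := by rw [Finset.sum_const, nsmul_eq_mul, mul_comm]

/-- The distribution of an additive operator in a gapped ground state satisfies a local Poincaré
inequality. -/
theorem IsAdditiveOn.exists_localPoincare {k : ℕ} {g : ℝ} {H : Op N d} {E₀ δE : ℝ} {Ω : Space N d}
    (hH : IsLocalHamiltonian k g H) (hg : IsUniqueGroundState H E₀ Ω)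
    (hgap : IsSpectralGap H E₀ δE) {L : Finset (Fin N)} {A : Op N d} (hL : L.Nonempty)
    (hA : IsAdditiveOn L A) :
    ∃ (n : ℕ) (b : OrthonormalBasis (Fin n) ℂ (Space N d)) (x : Fin n → ℝ), A = diagOp b x ∧
      LocalPoincare (fun j => ‖b.repr Ω j‖ ^ 2) x (2 * k) (2 * k * g) √(δE / L.card) := by
  classical
  obtain ⟨hsa, h, hsupp, hsum, hle⟩ := hH
  obtain ⟨a, ha, hA⟩ := hA
  obtain ⟨n, b, α, hα⟩ := exists_orthonormalBasis_of_commute (fun i : L => a i)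
    (fun i => (ha i i.2).1) (by
      intro i j
      by_cases hij : i = j
      · rw [hij]
      · exact (ha i i.2).2.2.commute (ha j j.2).2.2 
          (Finset.disjoint_singleton.mpr fun h => hij (Subtype.ext h)))
  have hα1 : ∀ i j, |α i j| ≤ 1 := by
    intro i j
    have h1 := (a i).le_opNorm (b j)
    rw [hα, norm_smul, b.norm_eq_one, Complex.norm_real, mul_one, mul_one] at h1
    exact h1.trans (ha i i.2).2.1
  refine ⟨n, b, fun j => ∑ i, α i j, ?_, ?_⟩
  · refine eq_diagOp b fun j => ?_
    rw [hA, ← Finset.sum_coe_sort, sum_apply, Complex.ofReal_sum, Finset.sum_smul]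
    exact Finset.sum_congr rfl fun i _ => hα i j
  intro f S hf hS
  have hδ := hgap.pos
  have hLpos : (0 : ℝ) < L.card := by exact_mod_cast hL.card_pos
  rw [Real.sq_sqrt (by positivity), div_mul_eq_mul_div, div_le_iff₀ hLpos]
  set x : Fin n → ℝ := fun j => ∑ i, α i j with hx
  set p : Fin n → ℝ := fun j => ‖b.repr Ω j‖ ^ 2 with hp
  have hp0 : ∀ j, 0 ≤ p j := fun j => sq_nonneg _
  let F := diagOp b fun j => f (x j)
  have hmain := gap_mul_le_re_inner_doubleCommutator hsa hg hgap
    (isSelfAdjoint_diagOp b fun j => f (x j))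
  rw [norm_sq_diagOp_apply, inner_diagOp, Complex.norm_real, Real.norm_eq_abs, sq_abs] at hmain
  have hvar : δE * (∑ j, p j * f (x j) ^ 2 - (∑ j, p j * f (x j)) ^ 2) ≤
      (inner ℂ Ω (doubleCommutator F H Ω)).re / 2 := by
    refine le_trans (le_of_eq ?_) hmain
    simp only [hp, mul_comm]
  have hterm : ∀ X ∈ Finset.univ.filter (fun X : Finset (Fin N) => X.card ≤ k),
      (inner ℂ Ω (doubleCommutator F (h X) Ω)).re ≤
        4 * k * mass p x S * (((L.filter (· ∈ X)).card : ℝ) * ‖h X‖) := by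
    intro X hX
    have hXk : X.card ≤ k := by simpa using hX
    -- the part of `A` outside of `X`
    let β : Fin n → ℝ := fun j => ∑ i ∈ Finset.univ.filter fun i : L => (i : Fin N) ∉ X, α i j
    set m : ℝ := ((L.filter (· ∈ X)).card : ℝ) with hm
    have hmk : m ≤ k := by
      rw [hm]
      exact_mod_cast (Finset.card_le_card fun i hi => (Finset.mem_filter.mp hi).2).trans hXk
    have hβ : diagOp b β = ∑ i ∈ Finset.univ.filter fun i : L => (i : Fin N) ∉ X, a i := by
      refine (eq_diagOp b fun j => ?_).symm
      rw [sum_apply, Complex.ofReal_sum, Finset.sum_smul]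
      exact Finset.sum_congr rfl fun i _ => hα i j
    have hcomm : Commute (h X) (diagOp b β) := by
      rw [hβ]
      refine Commute.sum_right _ _ _ fun i hi => ?_
      exact (hsupp X hXk).commute (ha i i.2).2.2
        (Finset.disjoint_singleton_right.mpr (Finset.mem_filter.mp hi).2)
    have hdist : ∀ j, |x j - β j| ≤ m := by
      intro j
      have e : x j - β j = ∑ i ∈ Finset.univ.filter fun i : L => (i : Fin N) ∈ X, α i j := by
        rw [sub_eq_iff_eq_add]
        exact (Finset.sum_filter_add_sum_filter_not _ _ _).symm
      have hcard : ((Finset.univ.filter fun i : L => (i : Fin N) ∈ X).card : ℝ) = m := by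
        rw [hm, ← Finset.card_map (Function.Embedding.subtype (· ∈ L))]
        congr 2
        ext i
        simp [and_comm]
      rw [e, ← hcard]
      refine (Finset.abs_sum_le_sum_abs _ _).trans ((Finset.sum_le_sum fun i _ => hα1 i j).trans ?_)
      simp
    have h1 := re_inner_doubleCommutator_le b hcomm hdist (κ := 2 * k) (by linarith) hf hS Ω
    refine h1.trans ?_
    have hm0 : 0 ≤ m := Nat.cast_nonneg _
    have h2 : m ^ 2 ≤ k * m := by rw [sq]; exact mul_le_mul_of_nonneg_right hmk hm0
    have h3 : 0 ≤ ‖h X‖ * mass p x S := mul_nonneg (norm_nonneg _) (mass_nonneg hp0 S)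
    calc 4 * m ^ 2 * ‖h X‖ * mass p x S = 4 * (m ^ 2 * (‖h X‖ * mass p x S)) := by ring
      _ ≤ 4 * (k * m * (‖h X‖ * mass p x S)) := by gcongr
      _ = _ := by ring
  have htot : (inner ℂ Ω (doubleCommutator F H Ω)).re ≤ 4 * k * mass p x S * (g * L.card) := by
    rw [hsum, doubleCommutator_sum, sum_apply, inner_sum, Complex.re_sum]
    refine (Finset.sum_le_sum hterm).trans ?_
    rw [← Finset.mul_sum]
    have := mass_nonneg (a := x) hp0 S
    exact mul_le_mul_of_nonneg_left (sum_card_mul_norm_le hle L) (by positivity)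
  linarith

end Poincare

/-! ### Spectral projections, expectations and variances -/

section Observables

variable {N d n : ℕ} (b : OrthonormalBasis (Fin n) ℂ (Space N d))

theorem expectation_diagOp (w : Fin n → ℝ) (v : Space N d) :
    expectation (diagOp b w) v = ∑ j, ‖b.repr v j‖ ^ 2 * w j := by
  rw [expectation, inner_diagOp, Complex.ofReal_re]
  exact Finset.sum_congr rfl fun j _ => mul_comm _ _

theorem variance_diagOp (w : Fin n → ℝ) (v : Space N d) :
    variance (diagOp b w) v =
      ∑ j, ‖b.repr v j‖ ^ 2 * w j ^ 2 - (∑ j, ‖b.repr v j‖ ^ 2 * w j) ^ 2 := by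
  rw [variance, sq (diagOp b w), diagOp_mul, expectation_diagOp, expectation_diagOp]
  simp only [sq]

theorem norm_spectralProjGE_diagOp_le (x : Fin n → ℝ) (t : ℝ) (v : Space N d) :
    ‖spectralProjGE (diagOp b x) t v‖ ≤
      √(mass (fun j => ‖b.repr v j‖ ^ 2) x (Set.Ici t)) := by
  let T : Op N d := diagOp b fun j => (Set.Ici t).indicator 1 (x j)
  have hsub : spectralSubspaceGE (diagOp b x) t ≤
      Module.End.eigenspace (T : Space N d →ₗ[ℂ] Space N d) 1 := by
    refine iSup_le fun μ u hu => ?_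
    rw [Module.End.mem_eigenspace_iff] at hu ⊢
    rw [one_smul]
    refine ext_repr b fun j => ?_
    have h1 : (x j : ℂ) * b.repr u j = (μ : ℝ) * b.repr u j := by
      rw [← repr_diagOp]
      have := congrArg (fun w => b.repr w j) hu
      simpa [-Complex.coe_smul] using this
    rw [ContinuousLinearMap.coe_coe, repr_diagOp]
    by_cases hj : x j = μ
    · have : x j ∈ Set.Ici t := by rw [hj]; exact μ.2
      rw [Set.indicator_of_mem this]
      simp
    · have h2 : ((x j : ℂ) - (μ : ℝ)) * b.repr u j = 0 := by rw [sub_mul, h1, sub_self]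
      have h3 : ((x j : ℂ) - (μ : ℝ)) ≠ 0 := by
        rw [sub_ne_zero]
        exact_mod_cast hj
      rw [(mul_eq_zero.mp h2).resolve_left h3, mul_zero]
  set V := spectralSubspaceGE (diagOp b x) t with hV
  change ‖V.starProjection v‖ ≤ _
  obtain ⟨w, hw⟩ : ∃ w, w = V.starProjection v := ⟨_, rfl⟩
  have hwV : w ∈ V := by rw [hw]; exact V.starProjection_apply_mem v
  have hTw : T w = w := by
    have := Module.End.mem_eigenspace_iff.mp (hsub hwV)
    simpa using this
  have hTv : ‖T v‖ = √(mass (fun j => ‖b.repr v j‖ ^ 2) x (Set.Ici t)) := by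
    rw [← Real.sqrt_sq (norm_nonneg (T v)), norm_sq_diagOp_apply]
    congr 1
    refine Finset.sum_congr rfl fun j _ => ?_
    by_cases hj : x j ∈ Set.Ici t
    · rw [Set.indicator_of_mem hj]; simp
    · rw [Set.indicator_of_notMem hj]; simp
  have h1 : ‖w‖ ^ 2 ≤ ‖w‖ * ‖T v‖ := by
    have e1 : inner ℂ w w = inner ℂ w v := by
      have h2 : inner ℂ w (v - V.starProjection v) = 0 :=
        (Submodule.mem_orthogonal V _).mp (V.sub_starProjection_mem_orthogonal v) w hwV
      rw [← hw, inner_sub_right, sub_eq_zero] at h2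
      exact h2.symm
    have e2 : inner ℂ w v = inner ℂ w (T v) := by
      conv_lhs => rw [← hTw]
      exact (isSelfAdjoint_diagOp b _).isSymmetric w v
    have e3 : ((‖w‖ ^ 2 : ℝ) : ℂ) = inner ℂ w (T v) := by
      rw [← e2, ← e1, inner_self_eq_norm_sq_to_K]; norm_cast
    have e4 := norm_inner_le_norm (𝕜 := ℂ) w (T v)
    rw [← e3, Complex.norm_real, Real.norm_of_nonneg (sq_nonneg _)] at e4
    exact e4
  rw [← hw, ← hTv]
  rcases (norm_nonneg w).eq_or_lt with h0 | h0
  · rw [← h0]; exact norm_nonneg _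
  · rw [sq] at h1
    exact le_of_mul_le_mul_left h1 h0

end Observables

end SpinSystem

theorem mainTheorem4 (k : ℕ) (g : ℝ) :
    ∃ c C : ℝ, 0 < c ∧ 0 < C ∧
      ∀ (N d : ℕ) (H : SpinSystem.Op N d) (E₀ δE : ℝ) (Ω : SpinSystem.Space N d),
        SpinSystem.IsLocalHamiltonian k g H →
        SpinSystem.IsUniqueGroundState H E₀ Ω →
        SpinSystem.IsSpectralGap H E₀ δE →
        (∀ (L : Finset (Fin N)) (A : SpinSystem.Op N d),
          L.Nonempty → SpinSystem.IsAdditiveOn L A →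
          (∀ h : ℝ, 0 < h →
            ‖SpinSystem.spectralProjGE A (SpinSystem.expectation A Ω + h) Ω‖ ≤
              Real.exp (-(c * h * Real.sqrt (δE / (L.card : ℝ))))) ∧
          δE * SpinSystem.variance A Ω ≤ C * (L.card : ℝ)) ∧
        (∀ A : SpinSystem.Op N d,
          SpinSystem.IsAdditiveOn Finset.univ A →
          SpinSystem.variance A Ω ≤ C * (N : ℝ) / δE ∧
          SpinSystem.fisherInformation A Ω ≤ 4 * C * (N : ℝ) / δE) := by
  obtain ⟨K, hK⟩ : ∃ K : ℝ, K = 2 * (k + 1) * (|g| + 1) := ⟨_, rfl⟩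
  obtain ⟨M, hM⟩ : ∃ M : ℝ, M = √(4 * |g|) * (2 * k) := ⟨_, rfl⟩
  have hK0 : 0 < K := by rw [hK]; positivity
  have hM0 : 0 ≤ M := by rw [hM]; positivity
  have hKg : 2 * k * g ≤ K := by
    rw [hK]
    calc 2 * k * g ≤ 2 * k * |g| := by gcongr; exact le_abs_self g
      _ ≤ _ := by gcongr <;> linarith
  refine ⟨1 / (16 * (M + √(8 * K))), K, by positivity, hK0, ?_⟩
  intro N d H E₀ δE Ω hH hg hgap
  have hδ := hgap.pos
  have hpart : ∀ (L : Finset (Fin N)) (A : SpinSystem.Op N d),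
      L.Nonempty → SpinSystem.IsAdditiveOn L A →
      (∀ h : ℝ, 0 < h →
        ‖SpinSystem.spectralProjGE A (SpinSystem.expectation A Ω + h) Ω‖ ≤
          Real.exp (-(1 / (16 * (M + √(8 * K))) * h * Real.sqrt (δE / (L.card : ℝ))))) ∧
      δE * SpinSystem.variance A Ω ≤ K * (L.card : ℝ) := by
    intro L A hL hA
    obtain ⟨n, b, x, rfl, hP'⟩ := hA.exists_localPoincare hH hg hgap hL
    have hp0 : ∀ j, 0 ≤ ‖b.repr Ω j‖ ^ 2 := fun j => sq_nonneg _
    have hp1 : ∑ j, ‖b.repr Ω j‖ ^ 2 = 1 := by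
      rw [← SpinSystem.norm_sq_eq_sum_repr, hg.norm_eq_one, one_pow]
    have hP : SpinSystem.LocalPoincare (fun j => ‖b.repr Ω j‖ ^ 2) x (2 * k) K
        √(δE / L.card) := fun f S hf hS =>
      (hP' f S hf hS).trans (mul_le_mul_of_nonneg_right hKg (SpinSystem.mass_nonneg hp0 S))
    have hL1 : (1 : ℝ) ≤ L.card := by exact_mod_cast hL.card_pos
    have hL0 : (0 : ℝ) < L.card := by linarith
    have hs : 0 < √(δE / L.card) := Real.sqrt_pos.mpr (by positivity)
    have hsM : √(δE / L.card) * (2 * k) ≤ M := by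
      rw [hM]
      gcongr
      obtain ⟨i, -⟩ := hL
      have h1 := SpinSystem.gap_le hH hg hgap i
      exact (div_le_self hδ.le hL1).trans (h1.trans (by linarith [le_abs_self g]))
    refine ⟨fun h hh => ?_, ?_⟩
    · rw [SpinSystem.expectation_diagOp]
      exact (SpinSystem.norm_spectralProjGE_diagOp_le b x _ Ω).trans
        (hP.sqrt_tail_le hp0 hp1 (by positivity) hK0 hs hsM hh)
    · rw [SpinSystem.variance_diagOp]
      have h1 := hP id Set.univ LipschitzWith.id (by simp)
      rw [SpinSystem.mass_univ hp1, Real.sq_sqrt (by positivity), div_mul_eq_mul_div,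
        div_le_iff₀ hL0, mul_one] at h1
      exact h1
  refine ⟨hpart, fun A hA => ?_⟩
  have hvar : SpinSystem.variance A Ω ≤ K * (N : ℝ) / δE := by
    rw [le_div_iff₀ hδ, mul_comm]
    rcases (Finset.univ : Finset (Fin N)).eq_empty_or_nonempty with h0 | hne
    · -- without spins, `A` is the empty sum
      obtain ⟨a, -, hA⟩ := hA
      rw [h0, Finset.sum_empty] at hA
      have : SpinSystem.variance A Ω = 0 := by
        simp [hA, SpinSystem.variance, SpinSystem.expectation]
      rw [this, mul_zero]
      positivity
    · simpa using (hpart Finset.univ A hne hA).2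
  refine ⟨hvar, ?_⟩
  rw [SpinSystem.fisherInformation]
  calc 4 * SpinSystem.variance A Ω ≤ 4 * (K * N / δE) := by gcongr
    _ = 4 * K * N / δE := by ring
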